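/- Let $X$ be a compact metrizable space. For compact metrizable $Y$ and a closed subspace $Z\subseteq Y$, let $X^Z$ be the space of all continuous maps $Z\to X$ with the compact-open topology (equivalently, the topology of uniform convergence), and let $X^{Z\uparrow Y}\subseteq X^Z$ be the set of those maps which extend to a continuous map $Y\to X$. The space $X$ is called $e$-open if $X^{Z\uparrow Y}$ is open in $X^Z$ for every compact metrizable space $Y$ and every closed subspace $Z\subseteq Y$. If $X$ is $e$-open and has finite covering dimension, then $X$ is an absolute neighborhood retract (ANR): whenever $i\colon X\to M$ is a closed embedding into a metrizable space $M$, there are an open set $U\supseteq i(X)$ in $M$ and a continuous map $r\colon U\to X$ with $r(i(x))=x$ for all $x\in X$. -/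

import Mathlib

universe u v w

/-- `X` is `e`-open: for every compact metrizable space `Y` and every closed subspace `Z` of `Y`,
the set of continuous maps `Z → X` which extend to a continuous map `Y → X` is open in the space
`C(Z, X)` of all continuous maps. The topology of `C(Z, X)` is the compact-open topology, which is
the topology of uniform convergence because `Z` is compact. Every compact metrizable space is
homeomorphic to one in any given universe, so the choice of the universe `w` does not matter. -/
def IsEOpen (X : Type u) [TopologicalSpace X] : Prop :=
  ∀ (Y : Type w) [TopologicalSpace Y] [CompactSpace Y] [TopologicalSpace.MetrizableSpace Y]
    (Z : Set Y), IsClosed Z →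
    IsOpen {φ : C(Z, X) | ∃ ψ : C(Y, X), ψ.restrict Z = φ}

/-- The covering dimension of `X` is at most `n`: every finite open cover of `X` has a finite open
refinement, covering `X`, such that every point lies in at most `n + 1` of its members. -/
def CoveringDimLE (X : Type*) [TopologicalSpace X] (n : ℕ) : Prop :=
  ∀ 𝒰 : Set (Set X), 𝒰.Finite → (∀ U ∈ 𝒰, IsOpen U) → ⋃₀ 𝒰 = Set.univ →
    ∃ 𝒱 : Set (Set X), 𝒱.Finite ∧ (∀ V ∈ 𝒱, IsOpen V) ∧ ⋃₀ 𝒱 = Set.univ ∧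
      (∀ V ∈ 𝒱, ∃ U ∈ 𝒰, V ⊆ U) ∧
      ∀ x : X, {V ∈ 𝒱 | x ∈ V}.encard ≤ (n : ℕ∞) + 1

/-- `X` is finite-dimensional: its covering dimension is finite. (For compact metrizable spaces the
covering dimension and the small and large inductive dimensions coincide.) -/
def IsFiniteDimensionalSpace (X : Type*) [TopologicalSpace X] : Prop :=
  ∃ n : ℕ, CoveringDimLE X n

/-- The (metrizable) space `X` is an absolute neighbourhood retract: whenever `X` is embedded as a
closed subspace of a metrizable space `Y`, it is a retract of a neighbourhood of it in `Y`. The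
ambient spaces `Y` range over all metrizable spaces, compact or not. -/
def IsANR (X : Type u) [TopologicalSpace X] : Prop :=
  ∀ (Y : Type v) [TopologicalSpace Y] [TopologicalSpace.MetrizableSpace Y] (i : X → Y),
    Topology.IsClosedEmbedding i →
    ∃ U : Set Y, IsOpen U ∧ ∃ hU : ∀ x : X, i x ∈ U,
      ∃ r : C(U, X), ∀ x : X, r ⟨i x, hU x⟩ = x

/-!
The proof rests on a uniform version of `e`-openness, `IsEOpen.exists_uniform_extension`: for every
`ε > 0` there is a `δ > 0` such that, for all closed `Z ⊆ Y` in a given compact metrizable space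
and every continuous `ψ : Y → X`, each continuous map `Z → X` that is `δ`-close to `ψ` on `Z`
extends to a continuous map `Y → X` that is `ε`-close to `ψ`. It is obtained by placing a sequence
of counterexamples in one compact space, over the points of `ℕ∞`.

Now let `X` be a closed subspace of a compact metrizable space `Q`, for instance of the Hilbert
cube. By the uniform version with `Y` a neighbourhood of `X` in `Q` and `Z = X`, some neighbourhood
of `X` retracts onto `X` as soon as there is a map `g` from a neighbourhood to `X` which is
`δ`-close to the identity on `X`. To construct `g`, a fine open cover of `X` of order at most
`n + 1` is enlarged to open subsets of `Q` that have the same intersection pattern near `X`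
(`exists_isOpen_enlargement`). The neighbourhood is filtered by the number of members of the cover
that contain a point, and `g` is extended over the `n + 1` strata in turn, each time by the uniform
version with a constant `ψ` (`IsEOpen.exists_continuousOn_dist_lt`). This replaces the usual map to
the nerve of the cover and the extension over its skeleta; neither simplicial complexes nor local
connectivity of `X` in all dimensions have to be introduced.

Finally, if `X` is a closed subspace of an arbitrary metrizable space `M`, the embedding of `X` in
the Hilbert cube extends to `M` by the Tietze theorem, and the retraction is pulled back to `M`.
-/

open Set Filter Topology TopologicalSpace

/-! ### Extending maps that are close to extendable maps -/

/-- Being `e`-open does not depend on the universe of the test spaces: a compact metrizable space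
is homeomorphic to a subspace of the Hilbert cube, which has a copy in every universe. -/
theorem IsEOpen.changeUniverse {X : Type u} [TopologicalSpace X] (hX : IsEOpen.{u, w} X) :
    IsEOpen.{u, v} X := by
  intro Y _ _ _ Z hZ
  let := metrizableSpaceMetric Y
  obtain ⟨e, he⟩ := Metric.PiNatEmbed.exists_embedding_to_hilbert_cube (X := Y)
  let h : Y ≃ₜ ULift.{w} (range e) := he.toHomeomorph.trans Homeomorph.ulift.symm
  have : CompactSpace (ULift.{w} (range e)) := h.compactSpace
  have : MetrizableSpace (ULift.{w} (range e)) := h.symm.isEmbedding.metrizableSpace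
  let Z' : Set (ULift.{w} (range e)) := h.symm ⁻¹' Z
  have hZ' : IsClosed Z' := hZ.preimage h.symm.continuous
  let k : C(Z', Z) := ⟨fun z => ⟨h.symm z, z.2⟩, by fun_prop⟩
  convert! (hX _ Z' hZ').preimage (ContinuousMap.continuous_precomp (Z := X) k) using 1
  ext φ
  constructor
  · rintro ⟨ψ, rfl⟩
    exact ⟨ψ.comp ⟨h.symm, h.symm.continuous⟩, rfl⟩
  · rintro ⟨ψ, hψ⟩
    refine ⟨ψ.comp ⟨h, h.continuous⟩, ?_⟩
    ext ⟨z, hz⟩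
    have hz' : h z ∈ Z' := by simpa [Z'] using hz
    simpa [k] using DFunLike.congr_fun hψ ⟨h z, hz'⟩

/-- The defining property of `e`-open spaces in terms of distances and of functions that are
continuous on a set. -/
theorem IsEOpen.exists_extension {X : Type u} [MetricSpace X] (hX : IsEOpen.{u, v} X)
    {P : Type v} [TopologicalSpace P] [CompactSpace P] [MetrizableSpace P] {Y Z : Set P}
    (hY : IsClosed Y) (hZ : IsClosed Z) (hZY : Z ⊆ Y) {ψ : P → X} (hψ : ContinuousOn ψ Y) :
    ∃ δ > 0, ∀ φ : P → X, ContinuousOn φ Z → (∀ z ∈ Z, dist (φ z) (ψ z) < δ) →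
      ∃ ψ' : P → X, ContinuousOn ψ' Y ∧ EqOn ψ' φ Z := by
  classical
  have : CompactSpace Y := isCompact_iff_compactSpace.1 hY.isCompact
  let Z' : Set Y := (↑) ⁻¹' Z
  have hZ' : IsClosed Z' := hZ.preimage continuous_subtype_val
  have : CompactSpace Z' := isCompact_iff_compactSpace.1 hZ'.isCompact
  let Ψ : C(Y, X) := ⟨Y.domRestrict ψ, continuousOn_iff_continuous_domRestrict.1 hψ⟩
  obtain ⟨δ, hδ, hball⟩ := Metric.isOpen_iff.1 (hX Y Z' hZ') (Ψ.restrict Z') ⟨Ψ, rfl⟩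
  refine ⟨δ, hδ, fun φ hφ hφψ => ?_⟩
  let Φ : C(Z', X) := ⟨fun z => φ z.1.1,
    hφ.comp_continuous (by fun_prop) fun z => z.2⟩
  obtain ⟨Ψ', hΨ'⟩ : ∃ Ψ' : C(Y, X), Ψ'.restrict Z' = Φ := by
    refine hball ?_
    rw [Metric.mem_ball, ContinuousMap.dist_lt_iff hδ]
    exact fun z => hφψ _ z.2
  refine ⟨fun y => if hy : y ∈ Y then Ψ' ⟨y, hy⟩ else ψ y, ?_, fun z hz => ?_⟩
  · rw [continuousOn_iff_continuous_domRestrict]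
    convert Ψ'.continuous using 1
    ext y
    simp
  · simpa [hZY hz, Φ] using DFunLike.congr_fun hΨ' ⟨⟨z, hZY hz⟩, hz⟩

/-- A sequence of closed subsets of `W`, placed on the slices over the finite points of `ℕ∞`,
together with the full slice over `⊤`, forms a closed set. -/
theorem isClosed_setOf_forall_natCast_eq {W : Type*} [TopologicalSpace W] {C : ℕ → Set W}
    (hC : ∀ n, IsClosed (C n)) :
    IsClosed {p : ℕ∞ × W | ∀ n : ℕ, p.1 = n → p.2 ∈ C n} := by
  simp only [ofPred_forall, imp_iff_not_or, ofPred_or]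
  refine isClosed_iInter fun n => .union ?_ ((hC n).preimage continuous_snd)
  exact ((ENat.isOpen_singleton (ENat.natCast_ne_top n)).preimage continuous_fst).isClosed_compl

/-- Let functions on the slices over the finite points of `ℕ∞` be given whose distances from a
continuous `π` tend to `0`. Together with `π` on the slice over `⊤` they form a continuous
function. -/
theorem continuousOn_of_forall_natCast_eq {W X : Type*} [TopologicalSpace W] [MetricSpace X]
    {Z : Set (ℕ∞ × W)} {f π : ℕ∞ × W → X} (hπ : Continuous π)
    (hf : ∀ n : ℕ, ContinuousOn f {p ∈ Z | p.1 = n})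
    (hfπ : ∀ p ∈ Z, ∀ n : ℕ, (n : ℕ∞) ≤ p.1 → dist (f p) (π p) < 1 / (n + 1)) :
    ContinuousOn f Z := by
  rintro ⟨t, w⟩ hp
  induction t using ENat.recTopCoe with
  | coe n =>
    refine (hf n _ ⟨hp, rfl⟩).mono_of_mem_nhdsWithin ?_
    exact inter_mem_nhdsWithin _ <|
      ((ENat.isOpen_singleton (ENat.natCast_ne_top n)).preimage continuous_fst).mem_nhds rfl
  | top =>
    have hdist : Tendsto (fun p => dist (f p) (π p)) (𝓝[Z] (⊤, w)) (𝓝 0) := by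
      rw [Metric.tendsto_nhds]
      intro ε hε
      obtain ⟨n, hn⟩ := exists_nat_one_div_lt hε
      have hn' : ∀ᶠ p : ℕ∞ × W in 𝓝[Z] (⊤, w), (n : ℕ∞) < p.1 :=
        nhdsWithin_le_nhds <| continuousAt_fst.eventually <|
          lt_mem_nhds (ENat.natCast_lt_top n)
      filter_upwards [hn', self_mem_nhdsWithin] with p hnp hpZ
      simpa using (hfπ p hpZ n hnp.le).trans hn
    have heq : f (⊤, w) = π (⊤, w) := by
      refine eq_of_forall_dist_le fun ε hε => ?_
      obtain ⟨n, hn⟩ := exists_nat_one_div_lt hε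
      exact ((hfπ _ hp n le_top).trans hn).le
    rw [ContinuousWithinAt, heq]
    refine tendsto_of_tendsto_of_dist (f₁ := π) hπ.continuousWithinAt ?_
    simpa only [dist_comm] using hdist

/-- The openness in the definition of `e`-open spaces is uniform, and extensions can be chosen
close to the given one. Suppose that there are counterexamples `Y n`, `Z n`, `ψ n`, `φ n` for
`δ = 1 / (n + 1)`. The graphs of the maps `ψ n`, placed over the points `n` of `ℕ∞`, and all of
`Q × X` over `⊤` form a compact space on which the projection to `X` restricts to every `ψ n`.
Replacing `ψ n` by `φ n` on `Z n` for all large `n` gives a continuous map close to the projection,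
and by continuity at `⊤` an extension of it is close to `ψ n` on the graph for large `n`. -/
theorem IsEOpen.exists_uniform_extension {X : Type u} [MetricSpace X] [CompactSpace X]
    (hX : IsEOpen.{u, w} X) (Q : Type v) [TopologicalSpace Q] [CompactSpace Q] [MetrizableSpace Q]
    {ε : ℝ} (hε : 0 < ε) :
    ∃ δ > 0, ∀ Y Z : Set Q, IsClosed Y → IsClosed Z → Z ⊆ Y → ∀ ψ φ : Q → X,
      ContinuousOn ψ Y → ContinuousOn φ Z → (∀ z ∈ Z, dist (φ z) (ψ z) < δ) →
      ∃ ψ' : Q → X, ContinuousOn ψ' Y ∧ EqOn ψ' φ Z ∧ ∀ y ∈ Y, dist (ψ' y) (ψ y) < ε := by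
  by_contra! hcon
  choose Y Z hY hZ hZY ψ φ hψ hφ hφψ hno using
    fun n : ℕ => hcon (1 / (n + 1 : ℝ)) Nat.one_div_pos_of_nat
  have hgraph : ∀ (n : ℕ) (A : Set Q), IsClosed A → A ⊆ Y n →
      IsClosed {q : Q × X | q.1 ∈ A ∧ q.2 = ψ n q.1} := by
    intro n A hA hAY
    have hc : ContinuousOn (fun q : Q × X => (q.2, ψ n q.1)) (Prod.fst ⁻¹' A) :=
      continuousOn_snd.prodMk (((hψ n).mono hAY).comp continuousOn_fst fun _ h => h)
    exact hc.preimage_isClosed_of_isClosed (hA.preimage continuous_fst) isClosed_diagonal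
  let 𝒴 : Set (ℕ∞ × Q × X) :=
    {p | ∀ n : ℕ, p.1 = n → p.2 ∈ {q : Q × X | q.1 ∈ Y n ∧ q.2 = ψ n q.1}}
  let 𝒵 : Set (ℕ∞ × Q × X) :=
    {p | ∀ n : ℕ, p.1 = n → p.2 ∈ {q : Q × X | q.1 ∈ Z n ∧ q.2 = ψ n q.1}}
  have h𝒴 : IsClosed 𝒴 :=
    isClosed_setOf_forall_natCast_eq fun n => hgraph n _ (hY n) subset_rfl
  have h𝒵 : IsClosed 𝒵 :=
    isClosed_setOf_forall_natCast_eq fun n => hgraph n _ (hZ n) (hZY n)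
  have h𝒵𝒴 : 𝒵 ⊆ 𝒴 := fun p hp n hn => ⟨hZY n (hp n hn).1, (hp n hn).2⟩
  let π : ℕ∞ × Q × X → X := fun p => p.2.2
  have hπ : Continuous π := by fun_prop
  obtain ⟨δ, hδ, hext⟩ :=
    (hX.changeUniverse : IsEOpen.{u, max u v} X).exists_extension h𝒴 h𝒵 h𝒵𝒴 hπ.continuousOn
  obtain ⟨m, hm⟩ := exists_nat_one_div_lt hδ
  let f : ℕ∞ × Q × X → X := fun p =>
    if (m : ℕ∞) ≤ p.1 ∧ p.1 ≠ ⊤ then φ p.1.toNat p.2.1 else π p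
  have hfπ : ∀ p ∈ 𝒵, ∀ n : ℕ, (n : ℕ∞) ≤ p.1 → dist (f p) (π p) < 1 / (n + 1) := by
    rintro ⟨t, q, x⟩ hp n hn
    by_cases h : (m : ℕ∞) ≤ t ∧ t ≠ ⊤
    · obtain ⟨k, rfl⟩ := ENat.ne_top_iff_exists.1 h.2
      obtain ⟨hq, rfl⟩ : q ∈ Z k ∧ x = ψ k q := hp k rfl
      have hnk : n ≤ k := by simpa using hn
      simp only [f, h, π]
      exact (hφψ k q hq).trans_le (Nat.one_div_le_one_div hnk)
    · simp only [f, h, if_false, dist_self]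
      exact Nat.one_div_pos_of_nat
  have hf : ContinuousOn f 𝒵 := by
    refine continuousOn_of_forall_natCast_eq hπ (fun n => ?_) hfπ
    by_cases h : m ≤ n
    · refine ContinuousOn.congr (f := fun p => φ n p.2.1) ?_ ?_
      · exact (hφ n).comp (by fun_prop) fun p hp => (hp.1 n hp.2).1
      · rintro ⟨_, q, x⟩ ⟨_, rfl⟩
        simp [f, h]
    · refine hπ.continuousOn.congr ?_
      rintro ⟨_, q, x⟩ ⟨_, rfl⟩
      simp [f, h]
  obtain ⟨g, hg, hgf⟩ := hext f hf fun p hp => by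
    by_cases h : (m : ℕ∞) ≤ p.1
    · exact (hfπ p hp m h).trans hm
    · simpa [f, h] using hδ
  -- The set where `g` is `ε`-far from `π` is compact and misses the slice over `⊤`.
  have hfar : IsClosed (Prod.fst '' {p ∈ 𝒴 | ε ≤ dist (g p) (π p)}) := by
    have hc : ContinuousOn (fun p => dist (g p) (π p)) 𝒴 := 
      continuous_dist.comp_continuousOn (hg.prodMk hπ.continuousOn)
    exact (hc.preimage_isClosed_of_isClosed h𝒴 isClosed_Ici).isCompact.image continuous_fst
      |>.isClosed
  have htop : ⊤ ∉ Prod.fst '' {p ∈ 𝒴 | ε ≤ dist (g p) (π p)} := by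
    rintro ⟨⟨_, q⟩, ⟨hp, hpε⟩, rfl⟩
    have hp' : ((⊤ : ℕ∞), q) ∈ 𝒵 := fun n hn => absurd hn (ENat.top_ne_natCast n)
    rw [hgf hp'] at hpε
    simp [f] at hpε
    exact hpε.not_gt hε
  obtain ⟨n, hn, hmn⟩ := ((ENat.tendsto_natCast_nhds_top.eventually
    (hfar.isOpen_compl.mem_nhds htop)).and (eventually_ge_atTop m)).exists
  have hslice : ∀ y ∈ Y n, ((n : ℕ∞), y, ψ n y) ∈ 𝒴 := by
    intro y hy k hk
    obtain rfl : n = k := by simpa using hk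
    exact ⟨hy, rfl⟩
  have hslice' : ∀ z ∈ Z n, ((n : ℕ∞), z, ψ n z) ∈ 𝒵 := by
    intro z hz k hk
    obtain rfl : n = k := by simpa using hk
    exact ⟨hz, rfl⟩
  obtain ⟨y, hy, hyε⟩ := hno n (fun y => g (n, y, ψ n y))
    (hg.comp (continuousOn_const.prodMk (continuousOn_id.prodMk (hψ n))) hslice)
    (fun z hz => by
      change g _ = _
      rw [hgf (hslice' z hz)]
      simp [f, hmn])
  exact hn ⟨_, ⟨hslice y hy, hyε⟩, rfl⟩

/-! ### Maps with prescribed approximate values on the members of a cover -/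

/-- Let `N` be covered by open sets `B i`, at most `k` of which contain any given point, and let
points `x i` of an `e`-open space be given which are close to each other for indices of intersecting
sets. Then there is a continuous map on `N` that is close to `x i` on `B i`.

This plays the role of extending a map from the vertices of the nerve of the cover to the whole
nerve. In place of the skeleta of the nerve there are the closed subsets of `N` formed by the points
which lie in at most `k` of the sets `B i`; the extension from one of them to the next one is done
separately for each `S` with `k + 1` elements, on the set of the points lying in no `B i` with
`i ∉ S`, where the map given so far is close to a constant. -/
theorem IsEOpen.exists_continuousOn_dist_lt {X : Type u} [MetricSpace X] [CompactSpace X]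
    [Nonempty X] (hX : IsEOpen.{u, w} X) (Q : Type v) [TopologicalSpace Q] [CompactSpace Q]
    [MetrizableSpace Q] (k : ℕ) {ε : ℝ} (hε : 0 < ε) :
    ∃ r > 0, ∀ (ι : Type*) [Finite ι] (N : Set Q) (B : ι → Set Q) (x : ι → X),
      IsClosed N → (∀ i, IsOpen (B i)) →
      N ⊆ ⋃ i, B i → (∀ y ∈ N, {i | y ∈ B i}.encard ≤ k) →
      (∀ y ∈ N, ∀ i j, y ∈ B i → y ∈ B j → dist (x i) (x j) < r) →
      ∃ g : Q → X, ContinuousOn g N ∧ ∀ y ∈ N, ∀ i, y ∈ B i → dist (g y) (x i) < ε := by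
  classical
  induction k generalizing ε with
  | zero =>
    refine ⟨1, one_pos, fun ι _ N B x _ _ hcov hcard _ => ?_⟩
    have hempty : N = ∅ := by
      refine eq_empty_of_forall_notMem fun y hy => ?_
      obtain ⟨i, hi⟩ := mem_iUnion.1 (hcov hy)
      have h0 : {i | y ∈ B i} = ∅ := by simpa using hcard y hy
      exact notMem_empty i (h0 ▸ hi)
    subst hempty
    exact ⟨fun _ => Classical.arbitrary X, continuousOn_empty _, by simp⟩
  | succ k ih =>
    obtain ⟨δ, hδ, hext⟩ := hX.exists_uniform_extension Q (half_pos hε)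
    obtain ⟨r, hr, hlow⟩ := ih (lt_min (half_pos hδ) hε)
    refine ⟨min r (min (δ / 2) (ε / 2)), by positivity, fun ι _ N B x hN hB hcov hcard hx => ?_⟩
    let I : Q → Set ι := fun y => {i | y ∈ B i}
    let N' : Set Q := {y ∈ N | (I y).encard ≤ k}
    have hN' : IsClosed N' := by
      suffices h : IsOpen {y | (I y).encard ≤ k}ᶜ from hN.inter (isOpen_compl_iff.1 h)
      rw [isOpen_iff_mem_nhds]
      intro y hy
      have hnear : ∀ᶠ z in 𝓝 y, ∀ i ∈ I y, i ∈ I z :=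
        (eventually_all_finite (toFinite _)).2 fun i hi => (hB i).mem_nhds hi
      filter_upwards [hnear] with z hz hzk
      exact hy ((encard_le_encard hz).trans hzk)
    have hNS : ∀ S : Set ι, IsClosed {y ∈ N | I y ⊆ S} := by
      intro S
      have : {y ∈ N | I y ⊆ S} = N ∩ ⋂ i ∈ Sᶜ, (B i)ᶜ := by
        ext y
        simp only [mem_ofPred_eq, mem_inter_iff, mem_iInter, mem_compl_iff, I]
        exact and_congr_right fun _ => forall_congr' fun i => not_imp_not.symm
      rw [this]
      exact hN.inter (isClosed_biInter fun i _ => (hB i).isClosed_compl)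
    obtain ⟨g, hg, hgx⟩ := hlow ι N' B x hN' hB (fun y hy => hcov hy.1) (fun y hy => hy.2)
      fun y hy i j hi hj => (hx y hy.1 i j hi hj).trans_le (min_le_left _ _)
    let 𝒮 : Set (Set ι) := {S | S.encard = k + 1 ∧ ∃ y ∈ N, I y = S}
    -- If `S` is in `𝒮`, then some `B i` with `i ∈ S` intersect, so the points `x i` are close to each
    -- other and `g` is close to any of them on the part of `N'` over `S`.
    have key : ∀ S : 𝒮, ∃ h : Q → X, ContinuousOn h {y ∈ N | I y ⊆ S} ∧
        EqOn h g ({y ∈ N | I y ⊆ S} ∩ N') ∧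
        ∀ y ∈ {y ∈ N | I y ⊆ S}, ∀ i ∈ S.1, dist (h y) (x i) < ε := by
      rintro ⟨_, hS, y₀, hy₀, rfl⟩
      obtain ⟨i₀, hi₀⟩ : (I y₀).Nonempty := by
        rw [← encard_ne_zero, hS]
        simp
      have hxx : ∀ i ∈ I y₀, dist (x i) (x i₀) < min r (min (δ / 2) (ε / 2)) :=
        fun i hi => hx y₀ hy₀ i i₀ hi hi₀
      obtain ⟨h, hh, hhg, hhx⟩ := hext _ _ (hNS (I y₀)) ((hNS (I y₀)).inter hN')
        inter_subset_left (fun _ => x i₀) g continuousOn_const (hg.mono inter_subset_right) <| by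
          rintro y ⟨⟨_, hyS⟩, hy'⟩
          obtain ⟨i, hi⟩ := mem_iUnion.1 (hcov hy'.1)
          have h1 := (hgx y hy' i hi).trans_le (min_le_left _ _)
          have h2 := (hxx i (hyS hi)).trans_le ((min_le_right _ _).trans (min_le_left _ _))
          linarith [dist_triangle (g y) (x i) (x i₀)]
      refine ⟨h, hh, hhg, fun y hy i hi => ?_⟩
      have h1 := hhx y hy
      have h2 := (hxx i hi).trans_le ((min_le_right _ _).trans (min_le_right _ _))
      linarith [dist_triangle_right (h y) (x i) (x i₀)]
    choose h hh hhg hhx using key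
    have hmem𝒮 : ∀ y ∈ N, y ∉ N' → I y ∈ 𝒮 := by
      intro y hy hy'
      refine ⟨le_antisymm (mod_cast hcard y hy) ?_, y, hy, rfl⟩
      exact Order.add_one_le_of_lt (not_le.1 fun hle => hy' ⟨hy, hle⟩)
    let G : Q → X := fun y =>
      if hy : y ∉ N' ∧ I y ∈ 𝒮 then h ⟨I y, hy.2⟩ y else g y
    have hG' : EqOn G g N' := fun y hy => by simp [G, hy]
    have hGS : ∀ S : 𝒮, EqOn G (h S) {y ∈ N | I y ⊆ S} := by
      intro S y hy
      by_cases hy' : y ∈ N'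
      · rw [hG' hy', hhg S ⟨hy, hy'⟩]
      · have hI := hmem𝒮 y hy.1 hy'
        have hIS : ⟨I y, hI⟩ = S := Subtype.ext <|
          (toFinite (I y)).eq_of_subset_of_encard_le hy.2 (S.2.1.trans hI.1.symm).le
        simp only [G, hy', hI, not_false_eq_true, and_self, dite_true, hIS]
    have hNeq : N = N' ∪ ⋃ S : 𝒮, {y ∈ N | I y ⊆ S} := by
      refine subset_antisymm (fun y hy => ?_)
        (union_subset (fun y hy => hy.1) (iUnion_subset fun S y hy => hy.1))
      by_cases hy' : y ∈ N'
      · exact .inl hy'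
      · exact .inr (mem_iUnion.2 ⟨⟨I y, hmem𝒮 y hy hy'⟩, hy, subset_rfl⟩)
    refine ⟨G, ?_, fun y hy i hi => ?_⟩
    · rw [hNeq]
      exact (hg.congr hG').union_of_isClosed
        ((locallyFinite_of_finite _).continuousOn_iUnion (fun S => hNS S)
          fun S => (hh S).congr (hGS S))
        hN' (isClosed_iUnion_of_finite fun S => hNS S)
    · by_cases hy' : y ∈ N'
      · rw [hG' hy']
        exact (hgx y hy' i hi).trans_le (min_le_right _ _)
      · have hyS : y ∈ {z ∈ N | I z ⊆ I y} := ⟨hy, subset_rfl⟩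
        rw [hGS ⟨I y, hmem𝒮 y hy hy'⟩ hyS]
        exact hhx ⟨I y, hmem𝒮 y hy hy'⟩ y hyS i hi

/-! ### Neighbourhood retractions -/

/-- A finite cover of a closed subspace by open sets `V i` can be enlarged to open sets `B i` of the
ambient space which cover a neighbourhood `N`, without creating new intersections: any `B i`
containing a given point of `N` come from sets `V i` containing a common point. -/
theorem exists_isOpen_enlargement {X Q ι : Type*} [TopologicalSpace X] [CompactSpace X]
    [TopologicalSpace Q] [T4Space Q] [Finite ι] {e : X → Q} (he : IsClosedEmbedding e)
    {V : ι → Set X} (hV : ∀ i, IsOpen (V i)) (hcov : ⋃ i, V i = univ) :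
    ∃ (N : Set Q) (B : ι → Set Q), IsClosed N ∧ range e ⊆ interior N ∧ (∀ i, IsOpen (B i)) ∧
      N ⊆ ⋃ i, B i ∧ (∀ i, e ⁻¹' B i ⊆ V i) ∧ ∀ y ∈ N, ∃ x, ∀ i, y ∈ B i → x ∈ V i := by
  have : T4Space X := he.t4Space
  obtain ⟨f, hf⟩ := BumpCovering.exists_isSubordinate isClosed_univ V hV hcov.ge
  have hfV : ∀ i x, x ∉ V i → f i x = 0 := fun i x hx =>
    image_eq_zero_of_notMem_tsupport fun h => hx (hf i h)
  choose g hg using fun i => (f i).exists_extension' he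
  have hgf : ∀ i x, g i (e x) = f i x := fun i x => congr_fun (hg i) x
  -- Near `e x`, the extensions `g i` with `x ∉ V i` are small, which gives the second condition.
  let W : Set Q := (⋃ i, {y | 1 / 2 < g i y}) ∩ ⋃ x, ⋂ i ∈ {i | x ∉ V i}, {y | g i y < 1 / 2}
  have hW : IsOpen W := by
    refine (isOpen_iUnion fun i => isOpen_lt (by fun_prop) (by fun_prop)).inter ?_
    exact isOpen_iUnion fun x => (toFinite _).isOpen_biInter fun i _ =>
      isOpen_lt (by fun_prop) (by fun_prop)
  have heW : range e ⊆ W := by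
    rintro _ ⟨x, rfl⟩
    refine ⟨mem_iUnion.2 ⟨f.ind x (mem_univ x), ?_⟩, mem_iUnion.2 ⟨x, mem_iInter₂.2 fun i hi => ?_⟩⟩
    · rw [mem_ofPred_eq, hgf, f.ind_apply]
      norm_num
    · rw [mem_ofPred_eq, hgf, hfV i x hi]
      norm_num
  obtain ⟨N₀, hN₀, heN, hNW⟩ := normal_exists_closure_subset he.isClosed_range hW heW
  refine ⟨closure N₀, fun i => {y | 1 / 2 < g i y}, isClosed_closure,
    heN.trans (interior_maximal subset_closure hN₀), fun i => isOpen_lt (by fun_prop) (by fun_prop),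
    fun y hy => (hNW hy).1, fun i x hx => ?_, fun y hy => ?_⟩
  · by_contra hxV
    rw [mem_preimage, mem_ofPred_eq, hgf, hfV i x hxV] at hx
    norm_num at hx
  · obtain ⟨x, hx⟩ := mem_iUnion.1 (hNW hy).2
    refine ⟨x, fun i hi => ?_⟩
    by_contra hxV
    exact lt_asymm (show 1 / 2 < g i y from hi) (mem_iInter₂.1 hx i hxV)

/-- In a compact metric space of covering dimension at most `n` there are finite open covers of
order at most `n + 1` by sets contained in arbitrarily small balls. -/
theorem CoveringDimLE.exists_cover_subset_ball {X : Type*} [MetricSpace X] [CompactSpace X] {n : ℕ}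
    (hn : CoveringDimLE X n) {r : ℝ} (hr : 0 < r) :
    ∃ 𝒱 : Set (Set X), 𝒱.Finite ∧ (∀ V ∈ 𝒱, IsOpen V) ∧ ⋃₀ 𝒱 = univ ∧
      (∀ V ∈ 𝒱, ∃ c, V ⊆ Metric.ball c r) ∧ ∀ x, {V ∈ 𝒱 | x ∈ V}.encard ≤ (n : ℕ∞) + 1 := by
  obtain ⟨t, -, ht, hcov⟩ := finite_cover_balls_of_compact (isCompact_univ (X := X)) hr
  obtain ⟨𝒱, h1, h2, h3, h4, h5⟩ := hn ((Metric.ball · r) '' t) (ht.image _)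
    (by rintro _ ⟨c, _, rfl⟩; exact Metric.isOpen_ball)
    (by rw [sUnion_image]; exact univ_subset_iff.1 hcov)
  refine ⟨𝒱, h1, h2, h3, fun V hV => ?_, h5⟩
  obtain ⟨_, ⟨c, _, rfl⟩, hc⟩ := h4 V hV
  exact ⟨c, hc⟩

/-- The map given by `IsEOpen.exists_continuousOn_dist_lt`, for the enlargement of a fine cover of
`X`, is a map from a neighbourhood of `X` to `X` whose restriction to `X` is close to the
identity. Hence the identity of `X` extends to this neighbourhood as well. -/
theorem IsEOpen.exists_retraction_nhds {X : Type u} [MetricSpace X] [CompactSpace X] [Nonempty X]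
    (hX : IsEOpen.{u, w} X) (hdim : IsFiniteDimensionalSpace X) {Q : Type v} [TopologicalSpace Q]
    [CompactSpace Q] [MetrizableSpace Q] {e : X → Q} (he : IsClosedEmbedding e) :
    ∃ (N : Set Q) (ρ : Q → X), range e ⊆ interior N ∧ ContinuousOn ρ N ∧ ∀ x, ρ (e x) = x := by
  obtain ⟨n, hn⟩ := hdim
  obtain ⟨δ, hδ, hext⟩ := hX.exists_uniform_extension Q one_pos
  obtain ⟨r, hr, hr'⟩ := hX.exists_continuousOn_dist_lt Q (n + 1) (half_pos hδ)
  have hs : 0 < min (r / 2) (δ / 2) := by positivity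
  obtain ⟨𝒱, hfin, hopen, hcov, hball, hcard⟩ := hn.exists_cover_subset_ball hs
  have := hfin.to_subtype
  choose c hc using fun V : 𝒱 => hball V V.2
  obtain ⟨N, B, hN, heN, hB, hNB, hBV, hBx⟩ := exists_isOpen_enlargement he
    (fun V : 𝒱 => hopen V V.2) (by rw [← sUnion_eq_iUnion, hcov])
  obtain ⟨g, hg, hgc⟩ := hr' 𝒱 N B c hN hB hNB
    (fun y hy => by
      obtain ⟨x, hx⟩ := hBx y hy
      calc {V : 𝒱 | y ∈ B V}.encard
          = ((↑) '' {V : 𝒱 | y ∈ B V} : Set (Set X)).encard :=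
            (Subtype.val_injective.encard_image _).symm
        _ ≤ {V ∈ 𝒱 | x ∈ V}.encard := encard_le_encard <| by
            rintro _ ⟨V, hV, rfl⟩
            exact ⟨V.2, hx V hV⟩
        _ ≤ ((n + 1 : ℕ) : ℕ∞) := mod_cast hcard x)
    (fun y hy V V' hV hV' => by
      obtain ⟨x, hx⟩ := hBx y hy
      have h1 := (Metric.mem_ball.1 (hc V (hx V hV))).trans_le (min_le_left _ _)
      have h2 := (Metric.mem_ball.1 (hc V' (hx V' hV'))).trans_le (min_le_left _ _)
      linarith [dist_triangle_left (c V) (c V') x])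
  -- A left inverse of `e`, continuous on the range of `e`.
  let φ : Q → X := Function.invFun e
  have hφ : ∀ x, φ (e x) = x := Function.leftInverse_invFun he.injective
  have hφc : ContinuousOn φ (range e) := by
    rw [← image_univ]
    exact he.isEmbedding.continuousOn_image_iff.2 <| by
      simp only [Function.comp_def, hφ]
      exact continuousOn_id
  obtain ⟨ρ, hρ, hρφ, -⟩ := hext N (range e) hN he.isClosed_range (heN.trans interior_subset) g φ hg
    hφc <| by
      rintro _ ⟨x, rfl⟩
      have hx : e x ∈ N := interior_subset (heN ⟨x, rfl⟩)
      obtain ⟨V, hV⟩ := mem_iUnion.1 (hNB hx)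
      have h1 := hgc _ hx V hV
      have h2 := (Metric.mem_ball.1 (hc V (hBV V hV))).trans_le (min_le_right _ _)
      rw [hφ]
      linarith [dist_triangle_right x (g (e x)) (c V)]
  exact ⟨N, ρ, heN, hρ, fun x => by rw [hρφ ⟨x, rfl⟩, hφ]⟩

theorem mainTheorem5 (X : Type u) [TopologicalSpace X] [CompactSpace X]
    [TopologicalSpace.MetrizableSpace X] (hdim : IsFiniteDimensionalSpace X)
    (hX : IsEOpen.{u, w} X) : IsANR.{u, v} X := by
  intro Y _ _ i hi
  rcases isEmpty_or_nonempty X with hempty | hne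
  · exact ⟨∅, isOpen_empty, isEmptyElim, ⟨fun y => y.2.elim, by fun_prop⟩, isEmptyElim⟩
  let := metrizableSpaceMetric X
  obtain ⟨e, he⟩ := Metric.PiNatEmbed.exists_embedding_to_hilbert_cube (X := X)
  have he' : IsClosedEmbedding e := ⟨he, (isCompact_range he.continuous).isClosed⟩
  obtain ⟨N, ρ, heN, hρ, hρe⟩ := hX.exists_retraction_nhds hdim he'
  obtain ⟨E, hE⟩ := ContinuousMap.exists_extension' hi ⟨e, he.continuous⟩
  have hEi : ∀ x, E (i x) = e x := congr_fun hE
  refine ⟨E ⁻¹' interior N, isOpen_interior.preimage E.continuous,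
    fun x => ?_, ⟨fun y => ρ (E y), ?_⟩, fun x => ?_⟩
  · rw [mem_preimage, hEi]
    exact heN ⟨x, rfl⟩
  · exact hρ.comp_continuous (by fun_prop) fun y => interior_subset y.2
  · change ρ (E (i x)) = x
    rw [hEi, hρe]
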